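/- Let $\Phi\subset V$ be an irreducible (reduced, crystallographic) root system spanning the real vector space $V$, with simple roots $\Pi=\{\alpha_1,\dots,\alpha_r\}$, positive roots $\Phi^+$, Weyl group $W$ and highest root $\alpha_0=\sum_{i=1}^r n_i\alpha_i$. Let $\varpi_1^\vee,\dots,\varpi_r^\vee\in V^*$ be the fundamental coweights, i.e. the basis of $V^*$ dual to $\alpha_1,\dots,\alpha_r$, and let $J=\{i\in\{1,\dots,r\} : n_i=1\}$ be the set of indices of minuscule coweights. Let $$\mathcal A_0=\{\lambda\in V^* : 0\le\langle\lambda,\alpha\rangle\le 1\ \text{for all}\ \alpha\in\Phi^+\}$$ be the closed fundamental alcove; it is the simplex with vertices $v_0=0$ and $v_i=\varpi_i^\vee/n_i$ $(1\le i\le r)$, and these vertices are labelled by the nodes $0,1,\dots,r$ of the extended Dynkin diagram of $\Phi$ (the node $0$ corresponding to $-\alpha_0$). Put $$F_{P^\vee}=\{\lambda\in\mathcal A_0 : \langle\lambda,\alpha_i+\alpha_0\rangle\le1\ \text{for all}\ i\in J\}.$$ For $j\in J$ let $w_0$ be the longest element of $W$, let $w_0^j$ be the longest element of the Weyl group of the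 subsystem of $\Phi$ generated by $\{\alpha_i : i\neq j\}$, put $w_j=w_0^jw_0$, and let $\omega_j$ be the affine transformation $\lambda\mapsto w_j\lambda+\varpi_j^\vee$ of $V^*$. Then for every $j\in J$ there is a unique permutation $\sigma_j$ of the set of nodes $\{0,1,\dots,r\}$ with $\omega_j(v_k)=v_{\sigma_j(k)}$ for all $k$; it satisfies $\sigma_j^{-1}(0)\neq0$; and for every $\lambda=\sum_{i=1}^r\lambda_i\varpi_i^\vee\in F_{P^\vee}$ with $\langle\lambda,\alpha_j+\alpha_0\rangle=1$ one has $$\omega_j^{-1}(\lambda)=\lambda_j\,\varpi^\vee_{\sigma_j^{-1}(0)}+\sum_{\substack{1\le i\le r\\ \sigma_j(i)\neq0}}\lambda_{\sigma_j(i)}\,\varpi_i^\vee .$$ -/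

import Mathlib

namespace RootPairing.Base

noncomputable section

variable {ι V N : Type*} [AddCommGroup V] [Module ℝ V] [AddCommGroup N] [Module ℝ N]
  {P : RootPairing ι ℝ V N}

/-! ### Fundamental coweights -/

/-- The fundamental coweights `ϖ_i^∨ ∈ V^*`: the basis of `V^*` dual to the simple roots. -/
def fundamentalCoweight [P.IsRootSystem] (b : P.Base) (i : b.support) : N :=
  P.toLinearMap.flip.toPerfPair.symm (b.toWeightBasis.coord i)

theorem root_fundamentalCoweight [P.IsRootSystem] (b : P.Base) (i : b.support) (x : V) :
    P.toLinearMap x (b.fundamentalCoweight i) = b.toWeightBasis.repr x i := by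
  simp [fundamentalCoweight]

/-! ### The highest root -/

/-- `x ≤ y` in the root order: `y - x` is a sum of simple roots. -/
def RootLE (b : P.Base) (x y : V) : Prop :=
  y - x ∈ AddSubmonoid.closure (P.root '' b.support)

theorem repr_nonneg_of_mem_closure [P.IsRootSystem] (b : P.Base) {x : V}
    (hx : x ∈ AddSubmonoid.closure (P.root '' b.support)) (i : b.support) :
    0 ≤ b.toWeightBasis.repr x i := by
  induction hx using AddSubmonoid.closure_induction with
  | mem x hx =>
    obtain ⟨j, hj, rfl⟩ := hx
    classical
    have h := b.toWeightBasis_repr_root ⟨j, hj⟩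
    simp only at h
    rw [h, Finsupp.single_apply]
    split_ifs <;> norm_num
  | zero => simp
  | add x y _ _ hx hy => simpa using add_nonneg hx hy

theorem eq_zero_of_mem_closure_of_neg_mem [P.IsRootSystem] (b : P.Base) {x : V}
    (hx : x ∈ AddSubmonoid.closure (P.root '' b.support))
    (hx' : -x ∈ AddSubmonoid.closure (P.root '' b.support)) : x = 0 := by
  apply b.toWeightBasis.repr.injective
  ext i
  have h₁ := b.repr_nonneg_of_mem_closure hx i
  have h₂ := b.repr_nonneg_of_mem_closure hx' i
  simp only [map_neg, Finsupp.coe_neg, Pi.neg_apply] at h₂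
  simp only [map_zero, Finsupp.coe_zero, Pi.zero_apply]
  linarith

/-- A root is maximal if no other root is above it. -/
def IsMaxRoot (b : P.Base) (m : ι) : Prop :=
  ∀ n, b.RootLE (P.root m) (P.root n) → n = m

theorem exists_isMaxRoot_ge [Finite ι] [P.IsRootSystem] (b : P.Base) (k : ι) :
    ∃ m, b.IsMaxRoot m ∧ b.RootLE (P.root k) (P.root m) := by
  let po : PartialOrder ι :=
    { le := fun x y => b.RootLE (P.root x) (P.root y)
      le_refl := fun x => by simp [RootLE]
      le_trans := fun x y z h₁ h₂ => by
        have := add_mem h₁ h₂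
        simpa [RootLE] using this
      le_antisymm := fun x y h₁ h₂ => by
        have h := b.eq_zero_of_mem_closure_of_neg_mem h₁ (by simpa [RootLE] using h₂)
        exact (P.root.injective (sub_eq_zero.mp h)).symm }
  obtain ⟨m, hkm, hm⟩ := (Set.toFinite (Set.univ : Set ι)).exists_le_maximal (Set.mem_univ k)
  exact ⟨m, fun n hn => le_antisymm (hm.2 (Set.mem_univ n) hn) hn, hkm⟩

section

set_option linter.unusedSectionVars false

variable [Finite ι] [P.IsRootSystem] [P.IsCrystallographic] (b : P.Base) {m : ι}

theorem IsMaxRoot.mem_closure {b : P.Base} (hm : b.IsMaxRoot m) :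
    P.root m ∈ AddSubmonoid.closure (P.root '' b.support) := by
  refine (b.root_mem_or_neg_mem m).resolve_right fun h => ?_
  have h' := hm (P.reflectionPerm m m) (by
    have := add_mem h h
    simpa [RootLE, sub_eq_add_neg] using this)
  have h'' : -P.root m = P.root m := by simpa using congrArg P.root h'
  have h₂ : (2 : ℝ) • P.root m = 0 := by
    rw [two_smul]; nth_rewrite 1 [← h'']; simp
  exact P.ne_zero m ((smul_eq_zero.mp h₂).resolve_left two_ne_zero)

theorem IsMaxRoot.isPos {b : P.Base} (hm : b.IsMaxRoot m) : b.IsPos m := by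
  have h := hm.mem_closure
  by_contra hneg
  rw [← IsPos.neg_iff_not] at hneg
  obtain ⟨f, hf₀, hf₁, hf₂⟩ := b.exists_root_eq_sum_int (P.reflectionPerm m m)
  have hp : 0 < f := by
    refine hf₁.resolve_right fun hlt => ?_
    have h0 : 0 < b.height (P.reflectionPerm m m) := hneg
    rw [height_eq_sum hf₂] at h0
    exact absurd h0 (not_lt.mpr (Finset.sum_nonpos fun i _ => hlt.le i))
  have h' : -P.root m ∈ AddSubmonoid.closure (P.root '' b.support) := by
    have : -P.root m = ∑ j ∈ b.support, f j • P.root j := by rw [← hf₂]; simp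
    rw [this]
    refine sum_mem fun j hj => ?_
    have hfj : 0 ≤ f j := hp.le j
    obtain ⟨n, hn⟩ := Int.eq_ofNat_of_zero_le hfj
    rw [hn, natCast_zsmul]
    exact nsmul_mem (AddSubmonoid.subset_closure (Set.mem_image_of_mem _ hj)) n
  exact P.ne_zero m (b.eq_zero_of_mem_closure_of_neg_mem h h')

theorem IsMaxRoot.pairingIn_nonneg {b : P.Base} (hm : b.IsMaxRoot m) {j : ι}
    (hj : j ∈ b.support) : 0 ≤ P.pairingIn ℤ m j := by
  by_contra! hlt
  have hjC : P.root j ∈ AddSubmonoid.closure (P.root '' b.support) :=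
    AddSubmonoid.subset_closure ⟨j, hj, rfl⟩
  have hne : P.root m ≠ -P.root j := fun h => by
    refine P.ne_zero j (b.eq_zero_of_mem_closure_of_neg_mem hjC ?_)
    rw [← h]; exact hm.mem_closure
  obtain ⟨n, hn⟩ := P.root_add_root_mem_of_pairingIn_neg hlt hne
  have := hm n (by rw [RootLE, hn]; simpa using hjC)
  rw [this] at hn
  exact P.ne_zero j (by simpa using hn)

theorem pairing_eq_sum (i k : ι) :
    P.pairing i k = ∑ l : b.support, b.toWeightBasis.repr (P.root i) l * P.pairing l k := by
  have h := congrArg (fun x => P.toLinearMap x (P.coroot k))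
    (b.toWeightBasis.sum_repr (P.root i))
  simpa using h.symm

theorem IsMaxRoot.repr_pos [P.IsReduced] [P.IsIrreducible] {b : P.Base} (hm : b.IsMaxRoot m)
    (i : b.support) : 0 < b.toWeightBasis.repr (P.root m) i := by
  have hnn := b.repr_nonneg_of_mem_closure hm.mem_closure
  refine lt_of_le_of_ne (hnn i) fun h0 => ?_
  refine P.ne_zero m (b.toWeightBasis.repr.injective ?_)
  ext j
  simp only [map_zero, Finsupp.coe_zero, Pi.zero_apply]
  refine b.induction_on_cartanMatrix (fun l => b.toWeightBasis.repr (P.root m) l = 0)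
    (i := i) h0.symm ?_
  intro i j hi hij
  have hle : ∀ l ∈ (Finset.univ : Finset b.support),
      b.toWeightBasis.repr (P.root m) l * P.pairing l i ≤ 0 := by
    intro l _
    rcases eq_or_ne l i with rfl | hli
    · rw [hi, zero_mul]
    · refine mul_nonpos_of_nonneg_of_nonpos (hnn l) ?_
      have := b.pairingIn_le_zero_of_ne (fun h => hli (Subtype.ext h)) l.2 i.2
      rw [← P.algebraMap_pairingIn ℤ]
      simpa using this
  have hge : 0 ≤ P.pairing m i := by
    rw [← P.algebraMap_pairingIn ℤ]
    simpa using hm.pairingIn_nonneg i.2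
  rw [b.pairing_eq_sum] at hge
  have hz := (Finset.sum_eq_zero_iff_of_nonpos hle).mp
    (le_antisymm (Finset.sum_nonpos hle) hge) j (Finset.mem_univ j)
  refine (mul_eq_zero.mp hz).resolve_right fun hp => hij ?_
  rw [cartanMatrix_apply_eq_zero_iff_pairing]
  exact hp

theorem IsMaxRoot.unique [P.IsReduced] [P.IsIrreducible] {b : P.Base} {m n : ι}
    (hm : b.IsMaxRoot m) (hn : b.IsMaxRoot n) : m = n := by
  have hpos : 0 < P.pairing m n := by
    rw [b.pairing_eq_sum]
    obtain ⟨j, hj, hj'⟩ := hn.isPos.exists_mem_support_pos_pairingIn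
    refine Finset.sum_pos' (fun l _ => ?_) ⟨⟨j, hj⟩, Finset.mem_univ _, ?_⟩
    · refine mul_nonneg (hm.repr_pos l).le ?_
      rw [← P.algebraMap_pairingIn ℤ]
      have h := hn.pairingIn_nonneg l.2
      have : 0 ≤ P.pairingIn ℤ l n := by
        by_contra! hlt
        rw [P.pairingIn_lt_zero_iff] at hlt
        omega
      simpa using this
    · refine mul_pos (hm.repr_pos _) ?_
      rw [← P.algebraMap_pairingIn ℤ]
      simpa using hj'
  rw [← P.algebraMap_pairingIn ℤ] at hpos
  by_contra hne
  obtain ⟨k, hk⟩ := P.root_sub_root_mem_of_pairingIn_pos (by simpa using hpos) hne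
  rcases b.root_mem_or_neg_mem k with h | h
  · exact hne (hn m (by rwa [RootLE, ← hk]))
  · exact hne (hm n (by rw [RootLE, ← neg_sub, ← hk]; exact h)).symm

variable [P.IsReduced] [P.IsIrreducible]

theorem exists_highestRoot : ∃ m : ι, ∀ k, b.RootLE (P.root k) (P.root m) := by
  have : Nonempty ι := by
    by_contra h
    rw [not_nonempty_iff] at h
    have hV := IsIrreducible.nontrivial P
    have hs := IsRootSystem.span_root_eq_top (P := P)
    rw [Set.range_eq_empty, Submodule.span_empty] at hs
    exact bot_ne_top hs
  obtain ⟨m, hm, -⟩ := b.exists_isMaxRoot_ge (Classical.arbitrary ι)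
  refine ⟨m, fun k => ?_⟩
  obtain ⟨n, hn, hkn⟩ := b.exists_isMaxRoot_ge k
  rwa [hm.unique hn]

/-- (The index of) the highest root `α₀`: the root such that `α ≤ α₀` for every root `α`. -/
def highestRoot : ι := b.exists_highestRoot.choose

theorem rootLE_highestRoot (k : ι) : b.RootLE (P.root k) (P.root b.highestRoot) :=
  b.exists_highestRoot.choose_spec k

/-- The coefficients `n_i` in `α₀ = ∑ n_i α_i`. -/
def mark (i : b.support) : ℝ := b.toWeightBasis.repr (P.root b.highestRoot) i

/-- The set `J` of indices `i` with `n_i = 1`, i.e. such that `ϖ_i^∨` is minuscule. -/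
def IsMinuscule (i : b.support) : Prop := b.mark i = 1

/-! ### The Weyl group, its parabolic subgroups and their longest elements -/

/-- The action of an automorphism of the root system (in particular of an element of the Weyl
group) on `V^*`, contragredient to its action on `V`. -/
def dualAction (w : P.Aut) : N ≃ₗ[ℝ] N := Equiv.coweightEquiv P P w⁻¹

theorem smul_dualAction (w : P.Aut) (x : V) (y : N) :
    P.toLinearMap (w • x) (dualAction w y) = P.toLinearMap x y := by
  have h := LinearMap.congr_fun
    (Hom.weight_coweight_transpose_apply P P y (w⁻¹ : P.Aut).toHom) (w • x)
  have h' : (w⁻¹ : P.Aut).weightMap (w • x) = x := inv_smul_smul w x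
  simp only [LinearMap.dualMap_apply, h'] at h
  exact h.symm

/-- The subsystem of `Φ` generated by a set `K` of simple roots: the roots in their `ℤ`-span. -/
def subsystem (b : P.Base) (K : Set b.support) : Set ι :=
  {k | P.root k ∈ Submodule.span ℤ ((fun i : b.support => P.root i) '' K)}

/-- The Weyl group of the subsystem generated by `K`. For `K = Set.univ` it is `W`. -/
def subWeylGroup (b : P.Base) (K : Set b.support) : Subgroup P.Aut :=
  Subgroup.closure (Equiv.reflection P '' b.subsystem K)

theorem subWeylGroup_univ (b : P.Base) : b.subWeylGroup Set.univ = P.weylGroup := by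
  have h : b.subsystem Set.univ = Set.univ := by
    ext k
    have := b.root_mem_span_int k
    have himg : (fun i : b.support => P.root i) '' Set.univ = P.root '' b.support := by
      ext x; simp
    simpa [subsystem, -Set.image_univ, himg] using this
  rw [subWeylGroup, h, Set.image_univ, weylGroup]

/-- The length function of the subsystem generated by `K`: the number of positive roots of the
subsystem that `w` makes negative. -/
def subLength (b : P.Base) (K : Set b.support) (w : P.Aut) : ℕ :=
  {k ∈ b.subsystem K | b.IsPos k ∧ ¬ b.IsPos (Equiv.indexHom P w k)}.ncard

theorem exists_longest (b : P.Base) (K : Set b.support) :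
    ∃ w ∈ b.subWeylGroup K, ∀ w' ∈ b.subWeylGroup K, b.subLength K w' ≤ b.subLength K w := by
  have hfin : (b.subLength K '' (b.subWeylGroup K : Set P.Aut)).Finite := by
    refine (Set.finite_Iic (Nat.card ι)).subset ?_
    rintro _ ⟨w, -, rfl⟩
    exact Set.ncard_le_card _
  obtain ⟨w, hw, hmax⟩ := Set.exists_max_image _ id hfin ⟨_, 1, one_mem _, rfl⟩
  obtain ⟨w, hw, rfl⟩ := hw
  exact ⟨w, hw, fun w' hw' => hmax _ ⟨w', hw', rfl⟩⟩

/-- The longest element of the Weyl group of the subsystem generated by `K`. -/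
def longest (b : P.Base) (K : Set b.support) : P.Aut := (b.exists_longest K).choose

/-- The Weyl group element `w_j = w₀^j w₀`, where `w₀` is the longest element of `W` and `w₀^j` is
the longest element of the Weyl group of the subsystem generated by the `α_i` with `i ≠ j`. -/
def minusculeElt (b : P.Base) (j : b.support) : P.Aut :=
  b.longest {j}ᶜ * b.longest Set.univ

/-- The affine transformation `ω_j = t_{ϖ_j^∨} w_j` of `V^*`, i.e. `λ ↦ w_j λ + ϖ_j^∨`. -/
def omega (b : P.Base) (j : b.support) : N ≃ᵃ[ℝ] N :=
  AffineEquiv.constVAdd ℝ N (b.fundamentalCoweight j) *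
    (dualAction (b.minusculeElt j)).toAffineEquiv

theorem omega_apply (b : P.Base) (j : b.support) (x : N) :
    b.omega j x = dualAction (b.minusculeElt j) x + b.fundamentalCoweight j := by
  simp [omega, add_comm]

/-! ### The fundamental alcove, its vertices, and the polytope `F` -/

/-- The closed fundamental alcove `A₀`. -/
def alcove (b : P.Base) : Set N :=
  {x | ∀ k, b.IsPos k → 0 ≤ P.toLinearMap (P.root k) x ∧ P.toLinearMap (P.root k) x ≤ 1}

/-- The polytope `F_{P^∨}`: the points of `A₀` with `⟨λ, α_i + α₀⟩ ≤ 1` for all `i ∈ J`. -/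
def polytope : Set N :=
  {x ∈ b.alcove | ∀ i : b.support, b.IsMinuscule i →
    P.toLinearMap (P.root i + P.root b.highestRoot) x ≤ 1}

/-- The vertices of `A₀`, indexed by the nodes of the extended Dynkin diagram. The node `none` is
the extra node `0` (corresponding to `-α₀`) and the node `some i` corresponds to `α_i`; the vertex
of the former is `0`, that of the latter is `ϖ_i^∨ / n_i`. -/
def alcoveVertex : Option b.support → N
  | none => 0
  | some i => (b.mark i)⁻¹ • b.fundamentalCoweight i

end

end

end RootPairing.Base

namespace RootPairing.Base

section

variable {ι V N : Type*} [AddCommGroup V] [Module ℝ V] [AddCommGroup N] [Module ℝ N]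
  {P : RootPairing ι ℝ V N}

/-! ### Coordinates of roots with respect to the simple roots -/

section Coordinates

variable [P.IsRootSystem] (b : P.Base)

/-! Attach to the nodes the affine functions `a_0 = 1 - α₀` and `a_i = α_i`. The vertex `v_k` is the
unique common zero of the `a_v` with `v ≠ k` (`eq_alcoveVertex`). The element `w_j` permutes the
vectors `-α₀, α_1, …, α_r` and sends `-α₀` to `α_j` (`exists_perm_minusculeElt_smul`); translation
by `ϖ_j^∨` corrects the constant terms, so `a_{σ v}(ω_j x) = a_v(x)` (`extendedRoot_omega`). Hence
`ω_j` permutes the vertices by `σ`. The same identity says that the `i`-th coordinate of `ω_j⁻¹ λ`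
is `a_{σ i}(λ)`: this is `λ_{σ i}` if `σ i ≠ 0`, and otherwise `1 - ⟨λ, α₀⟩`, which equals `λ_j`
because `⟨λ, α_j + α₀⟩ = 1`.

The permutation rests on three facts: a longest element sends the simple roots of its subsystem to
negatives of simple roots (`exists_longest_smul_eq_neg`), `w₀ α₀ = -α₀`, and `w₀^j α_j = α₀` when
`n_j = 1` (`smul_root_eq_highestRoot`). -/

theorem repr_root_eq_intCast {k : ι} {f : ι → ℤ}
    (hf : P.root k = ∑ l ∈ b.support, f l • P.root l) (i : b.support) :
    b.toWeightBasis.repr (P.root k) i = f i := by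
  have h : P.root k = ∑ l : b.support, (f l : ℝ) • b.toWeightBasis l := by
    rw [hf, ← Finset.sum_coe_sort]
    exact Finset.sum_congr rfl fun l _ => by rw [toWeightBasis_apply, Int.cast_smul_eq_zsmul]
  rw [h, Module.Basis.repr_sum_self]

theorem height_eq_sum_repr (k : ι) :
    (b.height k : ℝ) = ∑ i, b.toWeightBasis.repr (P.root k) i := by
  obtain ⟨f, -, -, hf⟩ := b.exists_root_eq_sum_int k
  simp_rw [height_eq_sum hf, b.repr_root_eq_intCast hf]
  rw [Finset.sum_coe_sort b.support (fun l => (f l : ℝ))]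
  push_cast
  rfl

theorem isPos_iff_repr_nonneg {k : ι} :
    b.IsPos k ↔ ∀ i, 0 ≤ b.toWeightBasis.repr (P.root k) i := by
  constructor
  · intro h i
    rcases b.root_mem_or_neg_mem k with hk | hk
    · exact b.repr_nonneg_of_mem_closure hk i
    · have h' : (0 : ℝ) < b.height k := by exact_mod_cast h
      rw [b.height_eq_sum_repr] at h'
      refine absurd h' (not_lt.mpr (Finset.sum_nonpos fun l _ => ?_))
      simpa using b.repr_nonneg_of_mem_closure hk l
  · intro h
    rw [isPos_iff']
    have : (0 : ℝ) ≤ b.height k := by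
      rw [b.height_eq_sum_repr]
      exact Finset.sum_nonneg fun l _ => h l
    exact_mod_cast this

theorem not_isPos_iff_repr_nonpos {k : ι} :
    ¬ b.IsPos k ↔ ∀ i, b.toWeightBasis.repr (P.root k) i ≤ 0 := by
  rw [← IsPos.neg_iff_not, isPos_iff_repr_nonneg]
  simp

theorem isPos_iff_not_isPos_of_root_eq_neg {k l : ι} (h : P.root k = -P.root l) :
    b.IsPos k ↔ ¬ b.IsPos l := by
  rw [not_isPos_iff_repr_nonpos, isPos_iff_repr_nonneg]
  simp [h]

omit [P.IsRootSystem] in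
-- Some simple root pairs positively with a positive root. If the two differed, their difference
-- would be a root of height 0.
theorem mem_support_of_height_eq_one [Finite ι] [P.IsCrystallographic] {k : ι}
    (hk : b.height k = 1) : k ∈ b.support := by
  have hpos : b.IsPos k := by rw [isPos_iff, hk]; exact one_pos
  obtain ⟨l, hl, hlk⟩ := hpos.exists_mem_support_pos_pairingIn
  rw [P.zero_lt_pairingIn_iff'] at hlk
  by_contra hne
  obtain ⟨m, hm⟩ := P.root_sub_root_mem_of_pairingIn_pos hlk (by rintro rfl; exact hne hl)
  refine b.height_ne_zero m ?_
  rw [b.height_sub hm, hk, height_one_of_mem_support hl, sub_self]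

theorem mem_subsystem_iff {K : Set b.support} {k : ι} :
    k ∈ b.subsystem K ↔ ∀ i ∉ K, b.toWeightBasis.repr (P.root k) i = 0 := by
  constructor
  · intro h i hi
    replace h : P.root k ∈ Submodule.span ℤ ((fun i : b.support => P.root i) '' K) := h
    generalize P.root k = x at h ⊢
    induction h using Submodule.span_induction with
    | mem x hx =>
      obtain ⟨l, hl, rfl⟩ := hx
      simp only [b.toWeightBasis_repr_root]
      exact Finsupp.single_eq_of_ne (fun h => hi (h ▸ hl))
    | zero => simp
    | add x y _ _ hx hy => simp [hx, hy]
    | smul a x _ hx => simp [hx]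
  · intro h
    obtain ⟨f, -, -, hf⟩ := b.exists_root_eq_sum_int k
    change P.root k ∈ Submodule.span ℤ ((fun i : b.support => P.root i) '' K)
    rw [hf, ← Finset.sum_coe_sort]
    refine Submodule.sum_mem _ fun l _ => ?_
    by_cases hl : l ∈ K
    · exact Submodule.smul_mem _ _ (Submodule.subset_span ⟨l, hl, rfl⟩)
    · have := h l hl
      rw [b.repr_root_eq_intCast hf, Int.cast_eq_zero] at this
      simp [this]

omit [P.IsRootSystem] in
theorem coe_mem_subsystem {K : Set b.support} {i : b.support} (hi : i ∈ K) :
    (i : ι) ∈ b.subsystem K :=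
  Submodule.subset_span ⟨i, hi, rfl⟩

/-- A generating reflection changes a vector by a multiple of a root of the subsystem, which has no
component outside `K`. -/
theorem repr_smul_of_mem_subWeylGroup {K : Set b.support} {w : P.Aut}
    (hw : w ∈ b.subWeylGroup K) {i : b.support} (hi : i ∉ K) (x : V) :
    b.toWeightBasis.repr (w • x) i = b.toWeightBasis.repr x i := by
  induction hw using Subgroup.closure_induction generalizing x with
  | mem w hw =>
    obtain ⟨k, hk, rfl⟩ := hw
    simp [RootPairing.reflection_apply, b.mem_subsystem_iff.mp hk i hi]
  | one => simp
  | mul v w _ _ hv hw => rw [mul_smul, hv, hw]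
  | inv w _ hw =>
    have := hw (w⁻¹ • x)
    rw [smul_inv_smul] at this
    exact this.symm

theorem smul_eq_sum_repr (w : P.Aut) (x : V) :
    w • x = ∑ i, b.toWeightBasis.repr x i • w • P.root i := by
  conv_lhs => rw [← b.toWeightBasis.sum_repr x, Finset.smul_sum]
  exact Finset.sum_congr rfl fun i _ => by rw [smul_comm, toWeightBasis_apply]

/-- Turns negativity of `w` on simple roots into inequalities in the root order; the identities for
highest roots are all obtained by applying it to a difference of two roots. -/
theorem repr_smul_nonpos {w : P.Aut} {x : V}
    (hx : ∀ i, 0 ≤ b.toWeightBasis.repr x i)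
    (hw : ∀ i, b.toWeightBasis.repr x i ≠ 0 →
      ∀ l, b.toWeightBasis.repr (w • P.root i) l ≤ 0) (l : b.support) :
    b.toWeightBasis.repr (w • x) l ≤ 0 := by
  rw [b.smul_eq_sum_repr w x, map_sum, Finsupp.finsetSum_apply]
  refine Finset.sum_nonpos fun i _ => ?_
  by_cases hi : b.toWeightBasis.repr x i = 0
  · simp [hi]
  · simpa using mul_nonpos_of_nonneg_of_nonpos (hx i) (hw i hi l)

end Coordinates

/-! ### Longest elements -/

section Longest

theorem root_indexHom (w : P.Aut) (k : ι) : P.root (Equiv.indexHom P w k) = w • P.root k :=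
  Equiv.root_indexEquiv_eq_smul P k w

variable (b : P.Base)

theorem indexHom_mem_subsystem [P.IsRootSystem] {K : Set b.support} {w : P.Aut}
    (hw : w ∈ b.subWeylGroup K) {k : ι} (hk : k ∈ b.subsystem K) : Equiv.indexHom P w k ∈ b.subsystem K := by
  rw [mem_subsystem_iff] at hk ⊢
  intro i hi
  rw [root_indexHom, b.repr_smul_of_mem_subWeylGroup hw hi, hk i hi]

theorem reflection_mem_subWeylGroup {K : Set b.support} {i : b.support} (hi : i ∈ K) :
    Equiv.reflection P i ∈ b.subWeylGroup K :=
  Subgroup.subset_closure ⟨i, b.coe_mem_subsystem hi, rfl⟩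

variable [Finite ι] [P.IsRootSystem] [P.IsCrystallographic] [P.IsReduced]

/-- The reflection `s_i` permutes the positive roots other than `α_i`, so it carries the inversions
of `w` to inversions of `w s_i`, and `α_i` is a new one. -/
theorem subLength_lt_subLength_mul_reflection {K : Set b.support} {i : b.support} (hi : i ∈ K)
    {w : P.Aut} (hw : b.IsPos (Equiv.indexHom P w i)) :
    b.subLength K w < b.subLength K (w * Equiv.reflection P i) := by
  have hs : ∀ k, Equiv.indexHom P (Equiv.reflection P i) k = P.reflectionPerm i k := fun _ => rfl
  have hii : b.IsPos (i : ι) := isPos_of_mem_support i.2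
  set S := {k ∈ b.subsystem K | b.IsPos k ∧ ¬ b.IsPos (Equiv.indexHom P w k)} with hS
  have hiS : (i : ι) ∉ P.reflectionPerm i '' S := by
    rintro ⟨k, hk, hki⟩
    refine (b.isPos_iff_not_isPos_of_root_eq_neg (k := i) (l := k) ?_).mp hii hk.2.1
    have h := congrArg (P.reflection i ∘ P.root) hki
    simp only [Function.comp_apply, P.root_reflectionPerm, P.reflection_same,
      P.reflection_apply_self] at h
    rw [h, neg_neg]
  have hcard : (insert (i : ι) (P.reflectionPerm i '' S)).ncard = S.ncard + 1 := by
    rw [Set.ncard_insert_of_notMem hiS, Set.ncard_image_of_injective _ (Equiv.injective _)]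
  change S.ncard < _
  rw [← Nat.succ_le_iff, Nat.succ_eq_add_one, ← hcard]
  refine Set.ncard_le_ncard ?_
  rintro k (rfl | ⟨k, hk, rfl⟩)
  · refine ⟨b.coe_mem_subsystem hi, hii, ?_⟩
    rw [map_mul, Equiv.Perm.mul_apply, hs,
      ← b.isPos_iff_not_isPos_of_root_eq_neg (k := Equiv.indexHom P w i) (by simp)]
    exact hw
  · refine ⟨b.indexHom_mem_subsystem (b.reflection_mem_subWeylGroup hi) hk.1,
      hk.2.1.reflectionPerm i.2 ?_, ?_⟩
    · rintro rfl
      exact hk.2.2 hw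
    · rw [map_mul, Equiv.Perm.mul_apply, hs]
      simpa using hk.2.2

variable [P.IsIrreducible]

theorem longest_mem (K : Set b.support) : b.longest K ∈ b.subWeylGroup K :=
  (b.exists_longest K).choose_spec.1

theorem not_isPos_longest {K : Set b.support} {i : b.support} (hi : i ∈ K) :
    ¬ b.IsPos (Equiv.indexHom P (b.longest K) i) := fun h =>
  (b.subLength_lt_subLength_mul_reflection hi h).not_ge <|
    (b.exists_longest K).choose_spec.2 _
      (mul_mem (b.longest_mem K) (b.reflection_mem_subWeylGroup hi))

theorem not_isPos_inv_longest {K : Set b.support} {i : b.support} (hi : i ∈ K) :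
    ¬ b.IsPos (Equiv.indexHom P (b.longest K)⁻¹ i) := by
  intro h
  have hk := b.indexHom_mem_subsystem (inv_mem (b.longest_mem K)) (b.coe_mem_subsystem hi)
  rw [mem_subsystem_iff] at hk
  have hsimple : b.IsPos (i : ι) := isPos_of_mem_support i.2
  refine b.not_isPos_iff_repr_nonpos.mpr ?_ hsimple
  -- `(longest K)⁻¹ α_i`, if positive, is a nonnegative combination of simple roots in `K`, so
  -- `longest K` would make it negative; but its image is `α_i`.
  intro m
  have := b.repr_smul_nonpos (w := b.longest K) (b.isPos_iff_repr_nonneg.mp h) (fun l hl m => by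
    have hlK : l ∈ K := by
      by_contra hlK
      exact hl (hk l hlK)
    rw [← root_indexHom]
    exact (b.not_isPos_iff_repr_nonpos.mp (b.not_isPos_longest hlK)) m) m
  rwa [root_indexHom, smul_inv_smul] at this

end Longest

/-! ### Action of longest elements on simple and highest roots -/

theorem exists_root_eq_neg_smul (w : P.Aut) (k : ι) : ∃ l, P.root l = -(w • P.root k) :=
  ⟨P.reflectionPerm (Equiv.indexHom P w k) (Equiv.indexHom P w k), by
    rw [P.root_reflectionPerm, P.reflection_apply_self, root_indexHom]⟩

section Opposition

variable [Finite ι] [P.IsRootSystem] [P.IsCrystallographic] [P.IsReduced] [P.IsIrreducible]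
  (b : P.Base)

theorem repr_longest_smul_nonpos {K : Set b.support} {i : b.support} (hi : i ∈ K)
    (l : b.support) : b.toWeightBasis.repr (b.longest K • P.root i) l ≤ 0 := by
  rw [← root_indexHom]
  exact b.not_isPos_iff_repr_nonpos.mp (b.not_isPos_longest hi) l

theorem repr_inv_longest_smul_nonpos {K : Set b.support} {i : b.support} (hi : i ∈ K)
    (l : b.support) : b.toWeightBasis.repr ((b.longest K)⁻¹ • P.root i) l ≤ 0 := by
  rw [← root_indexHom]
  exact b.not_isPos_iff_repr_nonpos.mp (b.not_isPos_inv_longest hi) l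

/-- Put `β = -u α_i`, a positive root of the subsystem. Expanding `β` in simple roots `α_l` and
applying `-u⁻¹` writes `α_i` as a combination of the `-u⁻¹ α_l`, each of height at least 1 for `l ∈
K`. Comparing heights gives `ht β ≤ ht α_i = 1`, so `β` is simple. -/
theorem exists_longest_smul_eq_neg {K : Set b.support} {i : b.support} (hi : i ∈ K) :
    ∃ l : b.support, b.longest K • P.root i = -P.root l := by
  set u := b.longest K with hu
  obtain ⟨k, hk⟩ := exists_root_eq_neg_smul u i
  have hpos : b.IsPos k := by
    rw [isPos_iff_repr_nonneg]
    intro l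
    simpa [hk] using b.repr_longest_smul_nonpos hi l
  have hK : ∀ l ∉ K, b.toWeightBasis.repr (P.root k) l = 0 := by
    intro l hl
    rw [hk, map_neg, Finsupp.neg_apply, b.repr_smul_of_mem_subWeylGroup (b.longest_mem K) hl,
      b.mem_subsystem_iff.mp (b.coe_mem_subsystem hi) l hl, neg_zero]
  have hroot : P.root i = ∑ l, b.toWeightBasis.repr (P.root k) l •
      -(P.root (Equiv.indexHom P u⁻¹ l)) := by
    simp_rw [root_indexHom, smul_neg, Finset.sum_neg_distrib]
    rw [← b.smul_eq_sum_repr, hk, smul_neg, inv_smul_smul, neg_neg]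
  have hone : (1 : ℝ) = ∑ l, b.toWeightBasis.repr (P.root k) l *
      -(b.height (Equiv.indexHom P u⁻¹ l) : ℝ) := by
    have h : ((b.height (i : ι) : ℤ) : ℝ) = 1 := by
      rw [height_one_of_mem_support i.2, Int.cast_one]
    rw [← h, b.height_eq_sum_repr]
    simp_rw [b.height_eq_sum_repr, ← Finset.sum_neg_distrib, Finset.mul_sum]
    rw [Finset.sum_comm]
    refine Finset.sum_congr rfl fun m _ => ?_
    conv_lhs => rw [hroot]
    simp
  have hle : (b.height k : ℝ) ≤ 1 := by
    rw [hone, b.height_eq_sum_repr]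
    refine Finset.sum_le_sum fun l _ => ?_
    by_cases hl : l ∈ K
    · refine le_mul_of_one_le_right (b.isPos_iff_repr_nonneg.mp hpos l) ?_
      have h := b.not_isPos_inv_longest hl
      rw [isPos_iff', ← hu] at h
      have : 1 ≤ -b.height (Equiv.indexHom P u⁻¹ l) := by omega
      exact_mod_cast this
    · simp [hK l hl]
  have hk1 : b.height k = 1 := le_antisymm (by exact_mod_cast hle) hpos
  exact ⟨⟨k, b.mem_support_of_height_eq_one hk1⟩, by simp [hk]⟩

theorem repr_root_le_mark (k : ι) (i : b.support) :
    b.toWeightBasis.repr (P.root k) i ≤ b.mark i := by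
  have := b.repr_nonneg_of_mem_closure (b.rootLE_highestRoot k) i
  simpa [mark] using this

theorem mark_pos (i : b.support) : 0 < b.mark i := by
  refine IsMaxRoot.repr_pos (fun n hn => P.root.injective ?_) i
  refine b.toWeightBasis.repr.injective (Finsupp.ext fun i => le_antisymm
    (b.repr_root_le_mark n i) ?_)
  simpa using b.repr_nonneg_of_mem_closure hn i

theorem root_eq_highestRoot {k : ι} (h : ∀ i, b.mark i ≤ b.toWeightBasis.repr (P.root k) i) :
    P.root k = P.root b.highestRoot :=
  b.toWeightBasis.repr.injective <| Finsupp.ext fun i =>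
    le_antisymm (b.repr_root_le_mark k i) (h i)

/-- Since `u` preserves the `α_j`-coefficient, `u⁻¹ α₀ - α_j` is a nonnegative combination of the
`α_i` with `i ≠ j`. Applying `u` gives `α₀ - u α_j ≤ 0`. This serves both for `w₀^j` and for its
inverse. -/
theorem smul_root_eq_highestRoot {j : b.support} (hj : b.IsMinuscule j) {u : P.Aut}
    (hu : u ∈ b.subWeylGroup {j}ᶜ)
    (hneg : ∀ i ≠ j, ∀ l, b.toWeightBasis.repr (u • P.root i) l ≤ 0) :
    u • P.root j = P.root b.highestRoot := by
  classical
  have hj' : j ∉ ({j}ᶜ : Set b.support) := by simp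
  rw [← root_indexHom]
  refine b.root_eq_highestRoot fun l => ?_
  set k := Equiv.indexHom P u⁻¹ b.highestRoot with hkdef
  have hkj : b.toWeightBasis.repr (P.root k) j = 1 := by
    rw [hkdef, root_indexHom, b.repr_smul_of_mem_subWeylGroup (inv_mem hu) hj']
    exact hj
  have hkpos : b.IsPos k := by
    by_contra h
    have := b.not_isPos_iff_repr_nonpos.mp h j
    linarith
  have hx : ∀ i, b.toWeightBasis.repr (P.root k - P.root j) i =
      if i = j then 0 else b.toWeightBasis.repr (P.root k) i := by
    intro i
    rw [map_sub, Finsupp.sub_apply, b.toWeightBasis_repr_root]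
    split_ifs with h
    · subst h; simp [hkj]
    · simp [Finsupp.single_eq_of_ne h]
  have h := b.repr_smul_nonpos (w := u) (x := P.root k - P.root j) (fun i => by
      rw [hx]
      split_ifs
      · exact le_rfl
      · exact b.isPos_iff_repr_nonneg.mp hkpos i)
    (fun i hi => hneg i fun h => hi (by rw [hx, if_pos h])) l
  rw [smul_sub, hkdef, root_indexHom, smul_inv_smul, map_sub, Finsupp.sub_apply] at h
  rw [root_indexHom]
  exact sub_nonpos.mp h

theorem longest_univ_smul_highestRoot :
    b.longest Set.univ • P.root b.highestRoot = -P.root b.highestRoot := by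
  set w := b.longest Set.univ with hw
  obtain ⟨k, hk⟩ := exists_root_eq_neg_smul w b.highestRoot
  -- `d` is the root `-w⁻¹ α₀`; applying `w` to `α₀ - d ≥ 0` gives `w α₀ + α₀ ≤ 0`.
  obtain ⟨d, hd⟩ := exists_root_eq_neg_smul w⁻¹ b.highestRoot
  rw [← neg_eq_iff_eq_neg, ← hk]
  refine b.root_eq_highestRoot fun l => ?_
  have h := b.repr_smul_nonpos (w := w) (x := P.root b.highestRoot - P.root d) (fun i => by
      simpa [mark] using b.repr_root_le_mark d i)
    (fun i _ => b.repr_longest_smul_nonpos (Set.mem_univ i)) l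
  rw [smul_sub, hd, smul_neg, smul_inv_smul, sub_neg_eq_add, map_add, Finsupp.add_apply] at h
  rw [hk, map_neg, Finsupp.neg_apply]
  unfold mark
  linarith

/-- The simple affine roots without their constant terms: `-α₀` at the node `none` and `α_i` at the
node `some i`. -/
noncomputable def extendedRoot : Option b.support → V
  | none => -P.root b.highestRoot
  | some i => P.root i

theorem extendedRoot_injective : Function.Injective b.extendedRoot := by
  have hne : ∀ i : b.support, -P.root b.highestRoot ≠ P.root i := fun i h => by
    have h' := congrArg (fun x => b.toWeightBasis.repr x i) h
    simp only [map_neg, Finsupp.neg_apply, b.toWeightBasis_repr_root, Finsupp.single_eq_same] at h'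
    have := b.mark_pos i
    unfold mark at this
    linarith
  rintro (_ | i) (_ | l) h
  · rfl
  · exact absurd h (hne l)
  · exact absurd h.symm (hne i)
  · exact congrArg some (Subtype.ext (P.root.injective h))

theorem minusculeElt_smul_extendedRoot_none {j : b.support} (hj : b.IsMinuscule j) :
    b.minusculeElt j • b.extendedRoot none = P.root j := by
  rw [minusculeElt, extendedRoot, mul_smul, smul_neg, b.longest_univ_smul_highestRoot, neg_neg,
    ← eq_inv_smul_iff]
  exact (b.smul_root_eq_highestRoot hj (inv_mem (b.longest_mem _))
    fun i hi => b.repr_inv_longest_smul_nonpos hi).symm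

theorem exists_minusculeElt_smul_extendedRoot {j : b.support} (hj : b.IsMinuscule j)
    (v : Option b.support) :
    ∃ v', b.minusculeElt j • b.extendedRoot v = b.extendedRoot v' := by
  rcases v with _ | i
  · exact ⟨some j, b.minusculeElt_smul_extendedRoot_none hj⟩
  · obtain ⟨l, hl⟩ := b.exists_longest_smul_eq_neg (Set.mem_univ i)
    rw [minusculeElt, mul_smul, extendedRoot, hl, smul_neg]
    -- Here `w₀ α_i = -α_l`; the factor `w₀^j` takes `α_l` to `α₀` if `l = j`, and to the negative
    -- of a simple root otherwise.
    rcases eq_or_ne l j with rfl | hlj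
    · refine ⟨none, ?_⟩
      rw [b.smul_root_eq_highestRoot hj (b.longest_mem _)
        fun i hi => b.repr_longest_smul_nonpos hi, extendedRoot]
    · obtain ⟨m, hm⟩ := b.exists_longest_smul_eq_neg (K := {j}ᶜ) hlj
      exact ⟨some m, by rw [hm, neg_neg, extendedRoot]⟩

theorem exists_perm_minusculeElt_smul {j : b.support} (hj : b.IsMinuscule j) :
    ∃ σ : Equiv.Perm (Option b.support), σ none = some j ∧
      ∀ v, b.minusculeElt j • b.extendedRoot v = b.extendedRoot (σ v) := by
  choose f hf using b.exists_minusculeElt_smul_extendedRoot hj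
  have hinj : Function.Injective f := fun v v' h => by
    refine b.extendedRoot_injective (MulAction.injective (b.minusculeElt j) ?_)
    simp only [hf, h]
  refine ⟨Equiv.ofBijective f (Finite.injective_iff_bijective.mp hinj), ?_, hf⟩
  refine b.extendedRoot_injective ?_
  rw [Equiv.ofBijective_apply, ← hf, b.minusculeElt_smul_extendedRoot_none hj, extendedRoot]

end Opposition

/-! ### The affine transformation on the alcove -/

section Alcove

variable [P.IsRootSystem] (b : P.Base)

open Classical in
theorem root_fundamentalCoweight_eq (i l : b.support) :
    P.toLinearMap (P.root i) (b.fundamentalCoweight l) = if i = l then 1 else 0 := by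
  rw [root_fundamentalCoweight, toWeightBasis_repr_root, Finsupp.single_apply]

theorem ext_of_root {x y : N}
    (h : ∀ i : b.support, P.toLinearMap (P.root i) x = P.toLinearMap (P.root i) y) : x = y := by
  refine P.toLinearMap.flip.toPerfPair.injective (b.toWeightBasis.ext fun i => ?_)
  simpa using h i

variable [Finite ι] [P.IsCrystallographic] [P.IsReduced] [P.IsIrreducible]

open Classical in
theorem extendedRoot_fundamentalCoweight {j : b.support} (hj : b.IsMinuscule j)
    (v : Option b.support) :
    P.toLinearMap (b.extendedRoot v) (b.fundamentalCoweight j) + (if v = none then 1 else 0) =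
      if v = some j then 1 else 0 := by
  rcases v with _ | i
  · have : b.toWeightBasis.repr (P.root b.highestRoot) j = 1 := hj
    simp [extendedRoot, root_fundamentalCoweight, this]
  · simp [extendedRoot, root_fundamentalCoweight_eq]

/-- Pairing with `ϖ_j^∨` moves the constant term 1 from the node `none` to the node `some j = σ
none`, which matches the relabelling by `σ`. -/
theorem extendedRoot_omega {j : b.support} (hj : b.IsMinuscule j)
    {σ : Equiv.Perm (Option b.support)} (hσ₀ : σ none = some j)
    (hσ : ∀ v, b.minusculeElt j • b.extendedRoot v = b.extendedRoot (σ v))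
    (v : Option b.support) (x : N) :
    P.toLinearMap (b.extendedRoot (σ v)) (b.omega j x) + (if σ v = none then 1 else 0) =
      P.toLinearMap (b.extendedRoot v) x + (if v = none then 1 else 0) := by
  have h := b.extendedRoot_fundamentalCoweight hj (σ v)
  simp only [← hσ₀, σ.injective.eq_iff] at h
  rw [omega_apply, map_add, add_assoc, h, ← hσ, smul_dualAction]

theorem extendedRoot_alcoveVertex {v v' : Option b.support} (h : v ≠ v') :
    P.toLinearMap (b.extendedRoot v) (b.alcoveVertex v') + (if v = none then 1 else 0) = 0 := by
  rcases v with _ | i <;> rcases v' with _ | l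
  · exact absurd rfl h
  · have hm : b.toWeightBasis.repr (P.root b.highestRoot) l ≠ 0 := (b.mark_pos l).ne'
    simp [extendedRoot, alcoveVertex, root_fundamentalCoweight, mark, hm]
  · simp [alcoveVertex]
  · have : i ≠ l := fun h' => h (congrArg some h')
    simp [extendedRoot, alcoveVertex, root_fundamentalCoweight_eq, this]

theorem highestRoot_apply (x : N) :
    P.toLinearMap (P.root b.highestRoot) x = ∑ i, b.mark i * P.toLinearMap (P.root i) x := by
  conv_lhs => rw [← b.toWeightBasis.sum_repr (P.root b.highestRoot)]
  simp [mark]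

theorem eq_alcoveVertex {x : N} {v' : Option b.support}
    (h : ∀ v, v ≠ v' →
      P.toLinearMap (b.extendedRoot v) x + (if v = none then 1 else 0) = 0) :
    x = b.alcoveVertex v' := by
  refine b.ext_of_root fun i => ?_
  have hsome : ∀ l : b.support, some l ≠ v' → P.toLinearMap (P.root l) x = 0 := fun l hl => by
    simpa [extendedRoot] using h (some l) hl
  have hsome' : ∀ l : b.support, some l ≠ v' →
      P.toLinearMap (P.root l) (b.alcoveVertex v') = 0 := fun l hl => by
    simpa [extendedRoot] using b.extendedRoot_alcoveVertex hl
  by_cases hi : some i = v'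
  · subst hi
    -- At `v' = some i` only the `i`-th coordinate survives, and `a_0(x) = 0` reads `n_i ⟨α_i, x⟩ =
    -- 1`.
    have h₁ : P.toLinearMap (P.root b.highestRoot) x = 1 := by
      have := h none (by simp)
      simp [extendedRoot] at this
      linarith
    rw [highestRoot_apply, Finset.sum_eq_single i
      (fun l _ hl => by rw [hsome l (by simpa using hl), mul_zero]) (by simp)] at h₁
    simp only [alcoveVertex, map_smul, root_fundamentalCoweight_eq, if_true, smul_eq_mul, mul_one]
    exact eq_inv_of_mul_eq_one_right h₁
  · rw [hsome i hi, hsome' i hi]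

theorem alcoveVertex_injective : Function.Injective b.alcoveVertex := by
  intro v v' h
  by_contra hne
  rcases v with _ | i
  · rcases v' with _ | l
    · exact hne rfl
    · have := b.extendedRoot_alcoveVertex hne
      rw [← h] at this
      simp [alcoveVertex] at this
  · have h₁ := b.extendedRoot_alcoveVertex hne
    rw [← h] at h₁
    have := b.mark_pos i
    simp [extendedRoot, alcoveVertex, root_fundamentalCoweight_eq, this.ne'] at h₁

end Alcove

end

end RootPairing.Base

open RootPairing.Base in
theorem mainTheorem5 {ι V N : Type*} [Finite ι]
    [AddCommGroup V] [Module ℝ V] [AddCommGroup N] [Module ℝ N]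
    (P : RootPairing ι ℝ V N) [P.IsRootSystem] [P.IsCrystallographic] [P.IsReduced]
    [P.IsIrreducible] (b : P.Base) (j : b.support) (hj : b.IsMinuscule j) :
    ∃ σ : Equiv.Perm (Option b.support),
      (∀ v, b.omega j (b.alcoveVertex v) = b.alcoveVertex (σ v)) ∧
      (∀ τ : Equiv.Perm (Option b.support),
        (∀ v, b.omega j (b.alcoveVertex v) = b.alcoveVertex (τ v)) → τ = σ) ∧
      ∃ k : b.support, σ⁻¹ none = some k ∧
        ∀ c : b.support → ℝ,
          ∑ i, c i • b.fundamentalCoweight i ∈ b.polytope →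
          P.toLinearMap (P.root j + P.root b.highestRoot)
            (∑ i, c i • b.fundamentalCoweight i) = 1 →
          (b.omega j)⁻¹ (∑ i, c i • b.fundamentalCoweight i) =
            c j • b.fundamentalCoweight k +
              ∑ i, (σ (some i)).elim 0 (fun l => c l • b.fundamentalCoweight i) := by
  obtain ⟨σ, hσ₀, hσ⟩ := b.exists_perm_minusculeElt_smul hj
  have hvert : ∀ v, b.omega j (b.alcoveVertex v) = b.alcoveVertex (σ v) := by
    refine fun v => b.eq_alcoveVertex fun v' hv' => ?_
    obtain ⟨v', rfl⟩ := σ.surjective v'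
    rw [b.extendedRoot_omega hj hσ₀ hσ,
      b.extendedRoot_alcoveVertex fun h => hv' (congrArg σ h)]
  refine ⟨σ, hvert, fun τ hτ => Equiv.ext fun v => b.alcoveVertex_injective ?_, ?_⟩
  · rw [← hτ, hvert]
  have hk : σ⁻¹ none ≠ none := fun h => by
    have := congrArg σ h
    simp [hσ₀] at this
  obtain ⟨k, hk⟩ := Option.ne_none_iff_exists'.mp hk
  refine ⟨k, hk, fun c _ hc => ?_⟩
  have hxi : ∀ i : b.support,
      P.toLinearMap (P.root i) (∑ i, c i • b.fundamentalCoweight i) = c i := fun i => by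
    simp [root_fundamentalCoweight_eq]
  generalize ∑ i, c i • b.fundamentalCoweight i = x at hc hxi ⊢
  have hσk : σ (some k) = none := by rw [← hk]; exact σ.apply_symm_apply none
  refine b.ext_of_root fun i => ?_
  classical
  -- Reads off the `i`-th coordinate of `ω_j⁻¹ x` as `a_{σ i}(x)`.
  have h := b.extendedRoot_omega hj hσ₀ hσ (some i) ((b.omega j)⁻¹ x)
  have hinv : b.omega j ((b.omega j)⁻¹ x) = x := (b.omega j).apply_symm_apply x
  have hterm : ∀ l : b.support, P.toLinearMap (P.root i)
      ((σ (some l)).elim 0 (fun m => c m • b.fundamentalCoweight l)) =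
        if i = l then (σ (some l)).elim 0 c else 0 := fun l => by
    cases σ (some l) <;> simp [root_fundamentalCoweight_eq]
  simp only [hinv, reduceCtorEq, if_false, add_zero] at h
  rw [map_add, map_sum (P.toLinearMap (P.root i)), Finset.sum_congr rfl fun l _ => hterm l,
    Finset.sum_ite_eq, if_pos (Finset.mem_univ i), map_smul, root_fundamentalCoweight_eq]
  refine h.symm.trans ?_
  by_cases hik : i = k
  · subst hik
    -- For `i = k` the coordinate is `a_0(x) = 1 - ⟨α₀, x⟩`, which the facet equation turns into `c
    -- j`.
    rw [map_add, LinearMap.add_apply, hxi] at hc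
    simp [hσk, extendedRoot]
    linarith
  · have hne : σ (some i) ≠ none := fun h' => hik (by
      rw [← hσk] at h'
      exact Option.some.inj (σ.injective h'))
    obtain ⟨m, hm⟩ := Option.ne_none_iff_exists'.mp hne
    simp [hm, extendedRoot, hxi, hik]
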